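/- For $p\in\mathbb{C}$ let $\mathrm{Li}_p$ denote the polylogarithm, i.e. the analytic continuation to $\mathbb{C}\setminus[1,\infty)$ of the series $\sum_{j\ge 1} w^j/j^p$, $|w|<1$. Let $\alpha\in(0,1)$ and $$\psi(z)=\frac{e^{z}-1}{\Gamma(2-\alpha)}\,\mathrm{Li}_{\alpha-1}(e^{-z}).$$ For $\theta\in(\pi/2,\pi)$ and $\delta,\tau>0$ let $$\Gamma_{\theta,\delta}=\{z\in\mathbb{C}: |z|=\delta,\ |\arg z|\le\theta\}\cup\{z=\rho e^{\pm \mathrm{i}\theta}:\ \rho\ge\delta\},\qquad \Gamma_\tau=\{z\in\Gamma_{\theta,\delta}: |\mathrm{Im}\, z|\le \pi/\tau\},$$ where $\arg$ and $z^\alpha$ are the principal branches. Then for every $\theta\in(\pi/2,5\pi/6)$ there is a constant $c>0$, depending only on $\alpha$ and $\theta$, such that for all $\delta>0$ and $\tau>0$ $$\left|\frac{1-e^{-z\tau}}{\tau^{\alpha}}\,\psi(z\tau)-z^\alpha\right|\le c\,|z|^2\tau^{2-\alpha}\qquad\text{for all } z\in\Gamma_\tau .$$ -/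

import Mathlib

open Complex Set MeasureTheory

/-- The split complex plane `ℂ ∖ [1, ∞)`. -/
def polylogDomain : Set ℂ := ((fun x : ℝ => (x : ℂ)) '' Ici (1 : ℝ))ᶜ

/-- `L` is an analytic continuation to `ℂ ∖ [1, ∞)` of the polylogarithm series
`∑_{j ≥ 1} w ^ j / j ^ p`, `|w| < 1` (the series is indexed here from `0`). -/
structure IsPolylog (p : ℂ) (L : ℂ → ℂ) : Prop where
  differentiableOn : DifferentiableOn ℂ L polylogDomain
  hasSum : ∀ w : ℂ, ‖w‖ < 1 → HasSum (fun j : ℕ => w ^ (j + 1) / ((j : ℂ) + 1) ^ p) (L w)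

theorem mem_polylogDomain_iff (w : ℂ) : w ∈ polylogDomain ↔ 1 - w ∈ slitPlane := by
  rw [polylogDomain, mem_slitPlane_iff_not_le_zero, mem_compl_iff, not_iff_not]
  constructor
  · rintro ⟨x, hx, rfl⟩
    have hx' : (1 : ℝ) ≤ x := hx
    simp [Complex.le_def, hx']
  · intro h
    rw [Complex.le_def] at h
    refine ⟨w.re, ?_, ?_⟩
    · have := h.1
      simp at this
      exact this
    · have h2 := h.2
      simp at h2
      apply Complex.ext <;> simp [h2]

theorem isOpen_polylogDomain : IsOpen polylogDomain := by
  have : polylogDomain = (fun w : ℂ => 1 - w) ⁻¹' slitPlane := by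
    ext w; exact mem_polylogDomain_iff w
  rw [this]
  exact isOpen_slitPlane.preimage (by fun_prop)

theorem ball_subset_polylogDomain : Metric.ball (0 : ℂ) 1 ⊆ polylogDomain := by
  intro w hw
  rw [mem_polylogDomain_iff]
  have h1 : ‖w‖ < 1 := by simpa using hw
  left
  have := (abs_le.1 (Complex.abs_re_le_norm w)).2
  simp
  linarith

theorem isPreconnected_polylogDomain : IsPreconnected polylogDomain := by
  have : polylogDomain = (fun w : ℂ => 1 - w) '' slitPlane := by
    ext w
    rw [mem_polylogDomain_iff]
    constructor
    · intro h; exact ⟨1 - w, h, by ring⟩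
    · rintro ⟨v, hv, rfl⟩
      simpa using hv
  rw [this]
  refine IsPreconnected.image ?_ _ (by fun_prop)
  exact (Complex.starConvex_one_slitPlane.isPathConnected
    Complex.one_mem_slitPlane).isConnected.isPreconnected

/-- The continuation is unique on the split plane. -/
theorem IsPolylog.eqOn {p : ℂ} {L M : ℂ → ℂ} (hL : IsPolylog p L) (hM : IsPolylog p M) :
    EqOn L M polylogDomain := by
  have h0 : (0 : ℂ) ∈ polylogDomain := ball_subset_polylogDomain (by simp)
  refine (hL.differentiableOn.analyticOnNhd isOpen_polylogDomain).eqOn_of_preconnected_of_eventuallyEq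
    (hM.differentiableOn.analyticOnNhd isOpen_polylogDomain) isPreconnected_polylogDomain h0 ?_
  filter_upwards [Metric.ball_mem_nhds (0 : ℂ) one_pos] with w hw
  exact (hL.hasSum w (by simpa using hw)).unique (hM.hasSum w (by simpa using hw))

theorem one_sub_mul_ne_zero {w : ℂ} (hw : w ∈ polylogDomain) {u : ℝ} (hu : u ∈ Icc (0 : ℝ) 1) :
    1 - w * (u : ℂ) ≠ 0 := by
  intro h
  have hu0 : u ≠ 0 := by
    rintro rfl
    simp at h
  have hpos : 0 < u := lt_of_le_of_ne hu.1 (Ne.symm hu0)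
  apply hw
  refine ⟨u⁻¹, ?_, ?_⟩
  · exact (one_le_inv₀ hpos).2 hu.2
  · have : (u : ℂ) ≠ 0 := by exact_mod_cast hu0
    push_cast
    field_simp
    linear_combination h

/-- Existence when `Re s > 0`, through Appell's integral. -/
theorem exists_isPolylog_of_pos {s : ℂ} (hs : 0 < s.re) : ∃ L, IsPolylog s L := by
  have hint : IntegrableOn (fun t : ℝ => ((Real.exp (-t) : ℝ) : ℂ) * (t : ℂ) ^ (s - 1)) (Ioi 0) :=
    Complex.GammaIntegral_convergent hs
  have hΓ : Complex.Gamma s ≠ 0 := Complex.Gamma_ne_zero_of_re_pos hs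
  obtain ⟨g, hg⟩ : ∃ g : ℝ → ℂ, g = fun t => ((Real.exp (-t) : ℝ) : ℂ) * (t : ℂ) ^ (s - 1) :=
    ⟨_, rfl⟩
  rw [← hg] at hint
  have hexp : ∀ t ∈ Ioi (0 : ℝ), Real.exp (-t) ∈ Icc (0 : ℝ) 1 := fun t ht =>
    ⟨(Real.exp_pos _).le, Real.exp_le_one_iff.2 (by have : (0 : ℝ) < t := ht; linarith)⟩
  refine ⟨fun w => w / Complex.Gamma s * ∫ t in Ioi (0 : ℝ), g t * (1 - w * (Real.exp (-t) : ℝ))⁻¹,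
    ?_, ?_⟩
  · refine DifferentiableOn.mul (by fun_prop) ?_
    intro w₀ hw₀
    obtain ⟨r, hr, hball⟩ := Metric.nhds_basis_closedBall.mem_iff.1
      (isOpen_polylogDomain.mem_nhds hw₀)
    have hcpt : IsCompact (Metric.closedBall w₀ r ×ˢ Icc (0 : ℝ) 1) :=
      (isCompact_closedBall w₀ r).prod isCompact_Icc
    have hcont : ContinuousOn (fun q : ℂ × ℝ => (1 - q.1 * (q.2 : ℂ))⁻¹)
        (Metric.closedBall w₀ r ×ˢ Icc (0 : ℝ) 1) := by
      refine ContinuousOn.inv₀ (by fun_prop) ?_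
      rintro ⟨w, u⟩ ⟨hw, hu⟩
      exact one_sub_mul_ne_zero (hball hw) hu
    obtain ⟨M, hM⟩ := hcpt.exists_bound_of_continuousOn hcont
    have hM' : ∀ w ∈ Metric.closedBall w₀ r, ∀ t ∈ Ioi (0 : ℝ),
        ‖(1 - w * (Real.exp (-t) : ℝ))⁻¹‖ ≤ M := fun w hw t ht => hM (w, Real.exp (-t)) ⟨hw, hexp t ht⟩
    have hmeas : ∀ w : ℂ, AEStronglyMeasurable (fun t : ℝ => g t * (1 - w * (Real.exp (-t) : ℝ))⁻¹)
        (volume.restrict (Ioi 0)) := fun w =>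
      hint.aestronglyMeasurable.mul (by
        apply Measurable.aestronglyMeasurable
        fun_prop)
    have key := hasDerivAt_integral_of_dominated_loc_of_deriv_le
      (μ := volume.restrict (Ioi (0 : ℝ))) (𝕜 := ℂ)
      (F := fun w t => g t * (1 - w * (Real.exp (-t) : ℝ))⁻¹)
      (F' := fun w t => g t * ((Real.exp (-t) : ℝ) * (1 - w * (Real.exp (-t) : ℝ))⁻¹ ^ 2))
      (x₀ := w₀) (s := Metric.ball w₀ r) (bound := fun t => ‖g t‖ * M ^ 2)
      (Metric.ball_mem_nhds w₀ hr)
      (Filter.Eventually.of_forall hmeas)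
      (by
        refine Integrable.mono' (hint.norm.mul_const M) (hmeas w₀) ?_
        filter_upwards [ae_restrict_mem measurableSet_Ioi] with t ht
        rw [norm_mul]
        exact mul_le_mul_of_nonneg_left (hM' w₀ (Metric.mem_closedBall_self hr.le) t ht)
          (norm_nonneg _))
      (hint.aestronglyMeasurable.mul (by
        apply Measurable.aestronglyMeasurable
        fun_prop))
      (by
        filter_upwards [ae_restrict_mem measurableSet_Ioi] with t ht w hw
        rw [norm_mul, norm_mul, norm_pow]
        refine mul_le_mul_of_nonneg_left ?_ (norm_nonneg _)
        have h1 := hM' w (Metric.ball_subset_closedBall hw) t ht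
        have h2 : ‖((Real.exp (-t) : ℝ) : ℂ)‖ ≤ 1 := by
          rw [Complex.norm_real, Real.norm_of_nonneg (hexp t ht).1]
          exact (hexp t ht).2
        calc _ ≤ 1 * M ^ 2 := by gcongr
          _ = M ^ 2 := one_mul _)
      (hint.norm.mul_const _)
      (by
        filter_upwards [ae_restrict_mem measurableSet_Ioi] with t ht w hw
        have hne := one_sub_mul_ne_zero (hball (Metric.ball_subset_closedBall hw)) (hexp t ht)
        have h1 : HasDerivAt (fun w : ℂ => 1 - w * ((Real.exp (-t) : ℝ) : ℂ))
            (-(1 * ((Real.exp (-t) : ℝ) : ℂ))) w :=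
          ((hasDerivAt_id w).mul_const _).const_sub 1
        have h2 := (h1.inv hne).const_mul (g t)
        refine h2.congr_deriv ?_
        rw [inv_pow]
        ring)
    exact key.2.differentiableAt.differentiableWithinAt
  · intro w hw
    have hterm : ∀ j : ℕ, ∫ t in Ioi (0 : ℝ), g t * (w * (Real.exp (-t) : ℝ)) ^ j =
        w ^ j * (Complex.Gamma s / ((j : ℂ) + 1) ^ s) := by
      intro j
      have hr : (0 : ℝ) < (j : ℝ) + 1 := by positivity
      have h := Complex.integral_cpow_mul_exp_neg_mul_Ioi (a := s) (r := (j : ℝ) + 1) hs hr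
      have hinv : (1 / (((j : ℝ) + 1 : ℝ) : ℂ)) ^ s = 1 / ((j : ℂ) + 1) ^ s := by
        rw [one_div, Complex.inv_cpow, one_div]
        · push_cast; rfl
        · rw [Complex.arg_ofReal_of_nonneg (by positivity)]
          exact Real.pi_pos.ne
      rw [hinv] at h
      rw [show w ^ j * (Complex.Gamma s / ((j : ℂ) + 1) ^ s) =
        w ^ j * (1 / ((j : ℂ) + 1) ^ s * Complex.Gamma s) by ring, ← h, ← integral_const_mul]
      refine integral_congr_ae (Filter.Eventually.of_forall fun t => ?_)
      simp only [hg]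
      rw [mul_pow]
      push_cast
      rw [← Complex.exp_nat_mul,
        show -(((j : ℂ) + 1) * (t : ℂ)) = -(t : ℂ) + (j : ℂ) * (-(t : ℂ)) by ring, Complex.exp_add]
      ring
    have hsum := hasSum_integral_of_dominated_convergence (μ := volume.restrict (Ioi (0 : ℝ)))
      (F := fun (j : ℕ) t => g t * (w * (Real.exp (-t) : ℝ)) ^ j)
      (f := fun t => g t * (1 - w * (Real.exp (-t) : ℝ))⁻¹)
      (fun j t => ‖g t‖ * ‖w‖ ^ j)
      (fun j => hint.aestronglyMeasurable.mul (by
        apply Measurable.aestronglyMeasurable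
        fun_prop))
      (fun j => by
        filter_upwards [ae_restrict_mem measurableSet_Ioi] with t ht
        rw [norm_mul, norm_pow]
        gcongr
        rw [norm_mul, Complex.norm_real, Real.norm_of_nonneg (hexp t ht).1]
        exact mul_le_of_le_one_right (norm_nonneg _) (hexp t ht).2)
      (Filter.Eventually.of_forall fun t =>
        Summable.mul_left ‖g t‖ (summable_geometric_of_lt_one (norm_nonneg w) hw))
      (by
        have e : (fun t : ℝ => ∑' j : ℕ, ‖g t‖ * ‖w‖ ^ j) =
            fun t => ‖g t‖ * ∑' j : ℕ, ‖w‖ ^ j := funext fun t => tsum_mul_left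
        rw [e]
        exact hint.norm.mul_const _)
      (by
        filter_upwards [ae_restrict_mem measurableSet_Ioi] with t ht
        have hq : ‖w * ((Real.exp (-t) : ℝ) : ℂ)‖ < 1 := by
          rw [norm_mul, Complex.norm_real, Real.norm_of_nonneg (hexp t ht).1]
          exact (mul_le_of_le_one_right (norm_nonneg w) (hexp t ht).2).trans_lt hw
        exact HasSum.mul_left (g t) (hasSum_geometric_of_norm_lt_one hq))
    have := hsum.mul_left (w / Complex.Gamma s)
    refine Eq.subst (motive := fun f => HasSum f _) (funext fun j => ?_) this
    rw [hterm]
    field_simp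
    ring

/-- Lowering the order: `Li_p = w d/dw Li_{p+1}`. -/
theorem IsPolylog.lower {p : ℂ} {L : ℂ → ℂ} (hL : IsPolylog (p + 1) L) :
    IsPolylog p (fun w => w * deriv L w) := by
  refine ⟨?_, ?_⟩
  · exact differentiableOn_id.mul (hL.differentiableOn.deriv isOpen_polylogDomain)
  · intro w hw
    obtain ⟨r, hwr, hr1⟩ := exists_between hw
    have hr0 : 0 ≤ r := (norm_nonneg w).trans hwr.le
    have hsumm : Summable (fun j : ℕ => ‖(r : ℂ) ^ (j + 1) / ((j : ℂ) + 1) ^ (p + 1)‖) :=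
      (hL.hasSum r (by rwa [Complex.norm_real, Real.norm_of_nonneg hr0])).summable.norm
    have hwU : w ∈ Metric.ball (0 : ℂ) r := by simpa using hwr
    have key := hasSum_deriv_of_summable_norm (U := Metric.ball (0 : ℂ) r)
      (F := fun (j : ℕ) (v : ℂ) => v ^ (j + 1) / ((j : ℂ) + 1) ^ (p + 1)) hsumm
      (fun j => by fun_prop) Metric.isOpen_ball
      (fun j v hv => by
        have hv' : ‖v‖ ≤ r := by simpa using (mem_ball_zero_iff.1 hv).le
        rw [norm_div, norm_div, norm_pow, norm_pow, Complex.norm_real, Real.norm_of_nonneg hr0]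
        gcongr) hwU
    have heq : deriv (fun v => ∑' j : ℕ, v ^ (j + 1) / ((j : ℂ) + 1) ^ (p + 1)) w = deriv L w := by
      apply Filter.EventuallyEq.deriv_eq
      filter_upwards [Metric.isOpen_ball.mem_nhds hwU] with v hv
      exact (hL.hasSum v ((mem_ball_zero_iff.1 hv).trans hr1)).tsum_eq
    rw [heq] at key
    have := key.mul_left w
    refine Eq.subst (motive := fun f => HasSum f _) (funext fun j => ?_) this
    have hj : ((j : ℂ) + 1) ≠ 0 := by exact_mod_cast Nat.succ_ne_zero j
    rw [deriv_div_const, deriv_pow_field, Complex.cpow_add _ _ hj, Complex.cpow_one]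
    have hjp : ((j : ℂ) + 1) ^ p ≠ 0 := by simp [Complex.cpow_eq_zero_iff, hj]
    push_cast
    field_simp
    simp [pow_succ']

theorem exists_isPolylog (p : ℂ) : ∃ L, IsPolylog p L := by
  have aux : ∀ (n : ℕ) (p : ℂ), 0 < p.re + n → ∃ L, IsPolylog p L := by
    intro n
    induction n with
    | zero => intro p hp; exact exists_isPolylog_of_pos (by simpa using hp)
    | succ n ih =>
      intro p hp
      obtain ⟨L, hL⟩ := ih (p + 1) (by push_cast at hp; simp; linarith)
      exact ⟨_, hL.lower⟩
  obtain ⟨n, hn⟩ := exists_nat_gt (-p.re)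
  exact aux n p (by linarith)

/-- The polylogarithm `Li_p` on `ℂ ∖ [1, ∞)`: the analytic continuation of
`∑_{j ≥ 1} w ^ j / j ^ p` (its values on the cut carry no meaning). -/
noncomputable def polylog (p : ℂ) : ℂ → ℂ := Classical.choose (exists_isPolylog p)

theorem isPolylog_polylog (p : ℂ) : IsPolylog p (polylog p) :=
  Classical.choose_spec (exists_isPolylog p)

/-- `ψ(z) = (e^z - 1) Li_{α-1}(e^{-z}) / Γ(2-α)`. -/
noncomputable def psi (α : ℝ) (z : ℂ) : ℂ :=
  (exp z - 1) / (Real.Gamma (2 - α) : ℂ) * polylog ((α : ℂ) - 1) (exp (-z))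

/-- The contour `Γ_{θ,δ}`: a circular arc of radius `δ` and two rays. -/
def contour (θ δ : ℝ) : Set ℂ :=
  {z : ℂ | ‖z‖ = δ ∧ |arg z| ≤ θ} ∪
    {z : ℂ | ∃ ρ : ℝ, δ ≤ ρ ∧ (z = ρ * exp (I * θ) ∨ z = ρ * exp (-(I * θ)))}

/-- The truncated contour `Γ_τ = {z ∈ Γ_{θ,δ} : |Im z| ≤ π / τ}`. -/
def truncatedContour (θ δ τ : ℝ) : Set ℂ :=
  {z : ℂ | z ∈ contour θ δ ∧ |z.im| ≤ Real.pi / τ}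

/-! Put `w = zτ`. Since `τ > 0`, `(zτ)^α = τ^α z^α`, so the claim reduces to `|(1 - e^{-w}) ψ(w) -
w^α| ≤ c |w|^2` for `w ≠ 0` with `Re w ≥ cos θ |w|` and `|Im w| ≤ π`. As `cos θ > -1`, this region
avoids the negative axis, and `e^{-w}` avoids the cut of the polylogarithm.

For small `w`, Poisson summation followed by analytic continuation gives `Li_{1-s}(e^{-w}) = Γ(s)
∑_k (w + 2πik)^{-s}` with `s = 2 - α > 1` (`polylog_cexp_neg_eq`). The term `k = 0` is singular and
the others have bounded sum. Since `(1 - e^{-w})(e^w - 1) = w^2 + O(w^4)`, the product is `w^α +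
O(w^2)`.

Away from the origin `|w|^2 ≥ 1`. For `Re w ≥ 1` the decay of `Li(e^{-w})` cancels the growth of
`e^w - 1`; what remains is compact. -/

/-! ### Laplace transform and Lipschitz's formula -/

/-- The Laplace transform of `t ^ (s - 1)` on the right half-plane. -/
theorem integral_rpow_mul_cexp_neg_mul {s : ℝ} (hs : 0 < s) {r : ℂ} (hr : 0 < r.re) :
    ∫ t in Ioi (0 : ℝ), ((t ^ (s - 1) : ℝ) : ℂ) * exp (-(r * t)) =
      Complex.Gamma s * r ^ (-s : ℂ) := by
  have hopen : IsOpen {z : ℂ | 0 < z.re} := isOpen_lt continuous_const continuous_re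
  have hconv : IsPreconnected {z : ℂ | 0 < z.re} := (convex_halfSpace_re_gt 0).isPreconnected
  have hint : ∀ (u b : ℝ), -1 < u → 0 < b →
      IntegrableOn (fun t : ℝ => t ^ u * Real.exp (-b * t)) (Ioi 0) := by
    intro u b hu hb
    simpa using integrableOn_rpow_mul_exp_neg_mul_rpow hu one_pos hb
  have hd : DifferentiableOn ℂ
      (fun z : ℂ => ∫ t in Ioi (0 : ℝ), ((t ^ (s - 1) : ℝ) : ℂ) * exp (-(z * t)))
      {z : ℂ | 0 < z.re} := by
    intro z₀ hz₀
    have hz₀' : 0 < z₀.re := hz₀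
    -- On this smaller half-plane `exp (-(z * t))` has a decay rate independent of `z`, which
    -- dominates the derivative.
    have hnhds : {z : ℂ | z₀.re / 2 < z.re} ∈ nhds z₀ :=
      (isOpen_lt continuous_const continuous_re).mem_nhds (by simp; linarith)
    have key := hasDerivAt_integral_of_dominated_loc_of_deriv_le
      (μ := volume.restrict (Ioi (0 : ℝ))) (𝕜 := ℂ)
      (F := fun z t => ((t ^ (s - 1) : ℝ) : ℂ) * exp (-(z * t)))
      (F' := fun z t => ((t ^ (s - 1) : ℝ) : ℂ) * (exp (-(z * t)) * (-(1 * (t : ℂ)))))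
      (x₀ := z₀) (bound := fun t => t ^ s * Real.exp (-(z₀.re / 2) * t))
      hnhds
      (Filter.Eventually.of_forall fun z => by
        apply Measurable.aestronglyMeasurable
        fun_prop)
      (by
        refine Integrable.mono' (hint (s - 1) z₀.re (by linarith) hz₀) ?_ ?_
        · apply Measurable.aestronglyMeasurable
          fun_prop
        · filter_upwards [ae_restrict_mem measurableSet_Ioi] with t ht
          have ht' : (0 : ℝ) < t := ht
          rw [norm_mul, Complex.norm_real, Real.norm_of_nonneg (by positivity), Complex.norm_exp]
          simp)
      (by
        apply Measurable.aestronglyMeasurable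
        fun_prop)
      (by
        filter_upwards [ae_restrict_mem measurableSet_Ioi] with t ht z hz
        have ht' : (0 : ℝ) < t := ht
        have hz' : z₀.re / 2 < z.re := hz
        rw [norm_mul, norm_mul, Complex.norm_real, Real.norm_of_nonneg (by positivity),
          Complex.norm_exp, norm_neg, one_mul, Complex.norm_real, Real.norm_of_nonneg ht'.le,
          mul_left_comm, mul_comm, show s = s - 1 + 1 by ring, Real.rpow_add_one ht'.ne']
        have : Real.exp (-(z * t)).re ≤ Real.exp (-(z₀.re / 2) * t) := by
          apply Real.exp_le_exp.2
          simp
          nlinarith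
        simp only [add_sub_cancel_right]
        calc _ ≤ t ^ (s - 1) * t * Real.exp (-(z * t)).re := by apply le_of_eq; ring
          _ ≤ _ := by gcongr)
      (hint s (z₀.re / 2) (by linarith) (by positivity))
      (by
        filter_upwards with t z hz
        exact (((hasDerivAt_id z).mul_const (t : ℂ)).neg.cexp).const_mul _)
    exact key.2.differentiableAt.differentiableWithinAt
  have hd' : DifferentiableOn ℂ (fun z : ℂ => Complex.Gamma s * z ^ (-s : ℂ))
      {z : ℂ | 0 < z.re} := by
    intro z hz
    have hz' : z ∈ slitPlane := Or.inl hz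
    exact ((differentiableAt_id.cpow_const hz').const_mul _).differentiableWithinAt
  -- Identity theorem: both sides are holomorphic and agree on the positive reals, which accumulate
  -- at `1`.
  refine (hd.analyticOnNhd hopen).eqOn_of_preconnected_of_frequently_eq
    (hd'.analyticOnNhd hopen) hconv (z₀ := 1) (by simp) ?_ hr
  have hreal : ∀ x : ℝ, 0 < x →
      ∫ t in Ioi (0 : ℝ), ((t ^ (s - 1) : ℝ) : ℂ) * exp (-((x : ℂ) * t)) =
        Complex.Gamma s * (x : ℂ) ^ (-s : ℂ) := by
    intro x hx
    have h := Complex.integral_cpow_mul_exp_neg_mul_Ioi (a := s) (r := x) (by simpa using hs) hx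
    rw [one_div, Complex.inv_cpow _ _ (by
      rw [Complex.arg_ofReal_of_nonneg hx.le]; exact Real.pi_pos.ne), ← Complex.cpow_neg] at h
    rw [mul_comm, ← h]
    refine setIntegral_congr_fun measurableSet_Ioi fun t ht => ?_
    have ht' : (0 : ℝ) < t := ht
    rw [Complex.ofReal_cpow ht'.le]
    push_cast
    rfl
  have htend : Filter.Tendsto (fun x : ℝ => (x : ℂ)) (nhdsWithin 1 {1}ᶜ) (nhdsWithin 1 {1}ᶜ) := by
    refine tendsto_nhdsWithin_iff.2 ⟨?_, ?_⟩
    · exact (Complex.continuous_ofReal.tendsto' 1 1 (by simp)).mono_left nhdsWithin_le_nhds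
    · filter_upwards [self_mem_nhdsWithin] with x hx
      simpa using hx
  refine htend.frequently (Filter.Eventually.frequently ?_)
  filter_upwards [nhdsWithin_le_nhds (lt_mem_nhds (zero_lt_one (α := ℝ)))] with x hx
  exact hreal x hx

/-- The norm is at least `2π|x| - ‖w‖ ≥ π(2|x| - 1) ≥ |x|`. This makes the terms `k ≠ 0` summable
uniformly in `w`. -/
theorem abs_le_norm_add_two_pi_mul_I {w : ℂ} (hw : ‖w‖ < Real.pi) {x : ℝ} (hx : 1 ≤ |x|) :
    |x| ≤ ‖w + 2 * Real.pi * I * x‖ := by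
  have h1 : ‖(2 * Real.pi * I * x : ℂ)‖ = 2 * Real.pi * |x| := by
    simp [abs_of_pos Real.pi_pos]
  have h2 := norm_sub_norm_le (2 * Real.pi * I * x : ℂ) (-w)
  rw [h1, norm_neg, sub_neg_eq_add, add_comm _ w] at h2
  nlinarith [Real.pi_gt_three]

theorem norm_add_two_pi_mul_I_cpow_le {s : ℝ} (hs : 0 < s) {w : ℂ} (hw : ‖w‖ < Real.pi) {x : ℝ}
    (hx : 1 ≤ |x|) : ‖(w + 2 * Real.pi * I * x) ^ (-s : ℂ)‖ ≤ |x| ^ (-s) := by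
  rw [← Complex.ofReal_neg, Complex.norm_cpow_real]
  exact Real.rpow_le_rpow_of_nonpos (by linarith) (abs_le_norm_add_two_pi_mul_I hw hx)
    (by linarith)

/-- Lipschitz's summation formula with a real exponent, near the origin of the right half-plane. -/
theorem tsum_rpow_mul_cexp_eq {s : ℝ} (hs : 1 < s) {w : ℂ} (hw : 0 < w.re) (hwπ : ‖w‖ < Real.pi) :
    ∑' n : ℕ, ((((n : ℝ) + 1) ^ (s - 1) : ℝ) : ℂ) * exp (-w) ^ (n + 1) =
      Complex.Gamma s * ∑' k : ℤ, (w + 2 * Real.pi * I * k) ^ (-s : ℂ) := by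
  -- Truncating by `max t 0` extends the function by zero to `t ≤ 0`; since `s > 1`, it stays
  -- continuous at `0`, as Poisson summation needs.
  obtain ⟨g, hg⟩ : ∃ g : ℝ → ℂ, g = fun t => ((max t 0 ^ (s - 1) : ℝ) : ℂ) * exp (-(w * t)) :=
    ⟨_, rfl⟩
  have hg0 : ∀ t ≤ 0, g t = 0 := by
    intro t ht
    simp [hg, max_eq_right ht, Real.zero_rpow (sub_pos.2 hs).ne']
  have hcont : Continuous g := by
    rw [hg]
    have : Continuous fun t : ℝ => max t 0 ^ (s - 1) :=
      (continuous_id.max continuous_const).rpow_const fun _ => Or.inr (by linarith)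
    fun_prop
  have hdecay : g =O[Filter.cocompact ℝ] fun x => |x| ^ (-s) := by
    rw [cocompact_eq_atBot_atTop, Asymptotics.isBigO_sup]
    constructor
    · refine Asymptotics.IsBigO.of_bound 0 ?_
      filter_upwards [Filter.eventually_le_atBot 0] with x hx
      simp [hg0 x hx]
    · have h1 := (isLittleO_exp_neg_mul_rpow_atTop hw (-s - (s - 1))).isBigO
      have h2 := (Asymptotics.isBigO_refl (fun x : ℝ => x ^ (s - 1)) Filter.atTop).mul h1
      refine Asymptotics.IsBigO.trans ?_ (h2.trans ?_)
      · refine Asymptotics.IsBigO.of_bound 1 ?_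
        filter_upwards [Filter.eventually_ge_atTop 0] with x hx
        rw [hg, norm_mul, Complex.norm_real, max_eq_left hx, Complex.norm_exp, norm_mul, one_mul]
        simp [abs_of_pos (Real.exp_pos _)]
      · refine Asymptotics.IsBigO.of_bound 1 ?_
        filter_upwards [Filter.eventually_gt_atTop 0] with x hx
        rw [← Real.rpow_add hx, abs_of_pos hx]
        ring_nf
        exact le_rfl
  have hF : ∀ x : ℝ, FourierTransform.fourier g x =
      Complex.Gamma s * (w + 2 * Real.pi * I * x) ^ (-s : ℂ) := by
    intro x
    rw [Real.fourier_real_eq_integral_exp_smul,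
      ← integral_rpow_mul_cexp_neg_mul (by linarith) (r := w + 2 * Real.pi * I * x) (by simpa),
      ← setIntegral_eq_integral_of_forall_compl_eq_zero (s := Ioi 0)]
    · refine setIntegral_congr_fun measurableSet_Ioi fun t ht => ?_
      have ht' : (0 : ℝ) ≤ t := le_of_lt ht
      simp only [hg, max_eq_left ht', smul_eq_mul]
      rw [mul_left_comm, ← Complex.exp_add]
      congr 2
      push_cast
      ring
    · intro t ht
      rw [hg0 t (not_lt.1 ht), smul_zero]
  have hFdecay : FourierTransform.fourier g =O[Filter.cocompact ℝ] fun x => |x| ^ (-s) := by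
    refine Asymptotics.IsBigO.of_bound ‖Complex.Gamma s‖ ?_
    filter_upwards [(tendsto_norm_cocompact_atTop (E := ℝ)).eventually_ge_atTop 1] with x hx
    rw [hF, norm_mul, Real.norm_of_nonneg (by positivity : 0 ≤ |x| ^ (-s))]
    gcongr
    exact norm_add_two_pi_mul_I_cpow_le (by linarith) hwπ hx
  have hP := Real.tsum_eq_tsum_fourier_of_rpow_decay hcont hs hdecay hFdecay 0
  simp only [zero_add, hF] at hP
  -- Only the integers `k ≥ 1` contribute, because `g` vanishes on `t ≤ 0`.
  have hinj : Function.Injective fun n : ℕ => ((n : ℤ) + 1) := fun a b h => by simpa using h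
  rw [← hinj.tsum_eq] at hP
  · rw [← tsum_mul_left]
    convert hP using 1
    · refine tsum_congr fun n => ?_
      have : (0 : ℝ) ≤ (n : ℝ) + 1 := by positivity
      simp only [hg]
      push_cast
      rw [max_eq_left this, ← Complex.exp_nat_mul]
      congr 2
      push_cast
      ring
    · simp
  · intro k hk
    have : 0 < k := by
      by_contra h
      exact hk (hg0 _ (by exact_mod_cast not_lt.1 h))
    exact ⟨(k - 1).toNat, by simp; omega⟩

/-! ### The polylogarithm near its branch point -/

theorem norm_ite_add_two_pi_mul_I_cpow_le {s : ℝ} (hs : 0 < s) {w : ℂ} (hw : ‖w‖ < Real.pi)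
    (k : ℤ) : ‖if k = 0 then 0 else (w + 2 * Real.pi * I * k) ^ (-s : ℂ)‖ ≤ |(k : ℝ)| ^ (-s) := by
  split_ifs with hk
  · simp only [norm_zero]
    positivity
  · have h1 : (1 : ℝ) ≤ |(k : ℝ)| := by exact_mod_cast Int.one_le_abs hk
    exact_mod_cast norm_add_two_pi_mul_I_cpow_le hs hw h1

theorem norm_tsum_ite_add_two_pi_mul_I_cpow_le {s : ℝ} (hs : 1 < s) {w : ℂ} (hw : ‖w‖ < Real.pi) :
    ‖∑' k : ℤ, if k = 0 then 0 else (w + 2 * Real.pi * I * k) ^ (-s : ℂ)‖ ≤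
      ∑' k : ℤ, |(k : ℝ)| ^ (-s) :=
  tsum_of_norm_bounded (Real.summable_abs_int_rpow hs).hasSum
    (norm_ite_add_two_pi_mul_I_cpow_le (by linarith) hw)

/-- If `e^{-w}` were real and at least `1`, then `sin (Im w) = 0` and `cos (Im w) > 0`. The bound on
`Im w` leaves only `Im w = 0`, the endpoints `±π` having cosine `-1`; then `w = -log x ≤ 0`, off the
slit plane. -/
theorem cexp_neg_mem_polylogDomain {w : ℂ} (hw : w ∈ slitPlane) (him : |w.im| ≤ Real.pi) :
    exp (-w) ∈ polylogDomain := by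
  rintro ⟨x, hx, hxw⟩
  have hx1 : (1 : ℝ) ≤ x := hx
  have hx0 : 0 < x := by linarith
  have h1 : -w = Real.log x + 0 := by
    have hre : x = Real.exp (-w.re) * Real.cos w.im := by
      simpa [Complex.exp_re] using congrArg Complex.re hxw
    have him' : 0 = Real.exp (-w.re) * Real.sin w.im := by
      simpa [Complex.exp_im] using congrArg Complex.im hxw
    have hsin : Real.sin w.im = 0 := by
      simpa [(Real.exp_pos _).ne'] using him'.symm
    have hcos : 0 < Real.cos w.im := by
      by_contra h
      nlinarith [Real.exp_pos (-w.re)]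
    have hw0 : w.im = 0 := by
      obtain ⟨h2, h3⟩ := abs_le.1 him
      rcases h2.eq_or_lt with h | h
      · rw [← h] at hcos
        norm_num at hcos
      rcases h3.eq_or_lt with h | h
      · rw [h] at hcos
        norm_num at hcos
      · exact (Real.sin_eq_zero_iff_of_lt_of_lt ‹_› h).1 hsin
    rw [hw0, Real.cos_zero, mul_one] at hre
    apply Complex.ext <;> simp [hw0, hre]
  have hlog := Real.log_nonneg hx1
  have hw' : w = ((-Real.log x : ℝ) : ℂ) := by
    push_cast
    linear_combination -h1
  rw [hw', ofReal_mem_slitPlane] at hw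
  linarith

/-- Near the origin, `Li_{1-s}(e^{-w})` is `Γ(s) w ^ (-s)` up to a bounded term. -/
theorem polylog_cexp_neg_eq {s : ℝ} (hs : 1 < s) {w : ℂ} (hw : w ∈ slitPlane)
    (hwπ : ‖w‖ < Real.pi) : polylog (1 - s) (exp (-w)) = Complex.Gamma s *
      (w ^ (-s : ℂ) + ∑' k : ℤ, if k = 0 then 0 else (w + 2 * Real.pi * I * k) ^ (-s : ℂ)) := by
  have hL := isPolylog_polylog (1 - s)
  have hU : IsOpen (Metric.ball (0 : ℂ) Real.pi ∩ slitPlane) :=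
    Metric.isOpen_ball.inter isOpen_slitPlane
  have h1U : (1 : ℂ) ∈ Metric.ball (0 : ℂ) Real.pi ∩ slitPlane :=
    ⟨by simpa using by linarith [Real.pi_gt_three], one_mem_slitPlane⟩
  -- The slit disc is star-shaped about `1`, hence connected.
  have hpre : IsPreconnected (Metric.ball (0 : ℂ) Real.pi ∩ slitPlane) :=
    ((((convex_ball (0 : ℂ) Real.pi).starConvex h1U.1).inter
      starConvex_one_slitPlane).isPathConnected h1U).isConnected.isPreconnected
  have hd1 : DifferentiableOn ℂ (fun w => polylog (1 - s) (exp (-w)))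
      (Metric.ball (0 : ℂ) Real.pi ∩ slitPlane) := by
    refine hL.differentiableOn.comp (by fun_prop) fun v hv => cexp_neg_mem_polylogDomain hv.2 ?_
    exact (abs_im_le_norm v).trans (mem_ball_zero_iff.1 hv.1).le
  have hd2 : DifferentiableOn ℂ (fun w : ℂ => Complex.Gamma s *
      (w ^ (-s : ℂ) + ∑' k : ℤ, if k = 0 then 0 else (w + 2 * Real.pi * I * k) ^ (-s : ℂ)))
      (Metric.ball (0 : ℂ) Real.pi ∩ slitPlane) := by
    refine (DifferentiableOn.add ?_ ?_).const_mul _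
    · exact fun v hv => (differentiableAt_id.cpow_const hv.2).differentiableWithinAt
    · refine differentiableOn_tsum_of_summable_norm (Real.summable_abs_int_rpow hs)
        (fun k v hv => ?_) hU
        fun k v hv => norm_ite_add_two_pi_mul_I_cpow_le (by linarith) (mem_ball_zero_iff.1 hv.1) k
      rcases eq_or_ne k 0 with rfl | hk
      · simpa using differentiableWithinAt_const _
      simp only [hk, if_false]
      refine DifferentiableAt.differentiableWithinAt ?_
      refine DifferentiableAt.cpow_const (by fun_prop) (Or.inr ?_)
      have h1 : (1 : ℝ) ≤ |(k : ℝ)| := by exact_mod_cast Int.one_le_abs hk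
      have h2 := (abs_im_le_norm v).trans_lt (mem_ball_zero_iff.1 hv.1)
      intro h
      simp at h
      have h3 : |v.im| = 2 * Real.pi * |(k : ℝ)| := by
        rw [eq_neg_of_add_eq_zero_left h, abs_neg, abs_mul, abs_of_pos (by positivity)]
      nlinarith [Real.pi_pos]
  refine (hd1.analyticOnNhd hU).eqOn_of_preconnected_of_eventuallyEq (hd2.analyticOnNhd hU)
    hpre h1U ?_ ⟨mem_ball_zero_iff.2 hwπ, hw⟩
  -- Near `1` one has `Re v > 0`, so `|e^{-v}| < 1` and the defining series meets Lipschitz's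
  -- formula.
  filter_upwards [hU.mem_nhds h1U,
    (isOpen_lt continuous_const continuous_re).mem_nhds (show (0 : ℝ) < (1 : ℂ).re by simp)]
    with v hv hre
  have hv' := mem_ball_zero_iff.1 hv.1
  have hsum : Summable fun k : ℤ => (v + 2 * Real.pi * I * k) ^ (-s : ℂ) := by
    refine (Real.summable_abs_int_rpow hs).of_norm_bounded_eventually ?_
    filter_upwards [(Set.finite_singleton (0 : ℤ)).compl_mem_cofinite] with k hk
    have hk' : k ≠ 0 := by simpa using hk
    simpa [hk'] using norm_ite_add_two_pi_mul_I_cpow_le (by linarith) hv' k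
  have hsplit := hsum.tsum_eq_add_tsum_ite 0
  simp only [Int.cast_zero, mul_zero, add_zero] at hsplit
  rw [← hsplit, ← tsum_rpow_mul_cexp_eq hs hre hv']
  refine ((hL.hasSum (exp (-v)) ?_).tsum_eq.symm).trans (tsum_congr fun n => ?_)
  · rw [Complex.norm_exp, Real.exp_lt_one_iff]
    simpa using hre
  · have h1 : ((n : ℂ) + 1) = (((n : ℝ) + 1 : ℝ) : ℂ) := by push_cast; rfl
    rw [show (s - 1 : ℝ) = -(1 - s) by ring, Real.rpow_neg (by positivity), h1,
      show (1 - s : ℂ) = ((1 - s : ℝ) : ℂ) by push_cast; rfl, Complex.ofReal_inv,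
      Complex.ofReal_cpow (by positivity), div_eq_inv_mul]

/-! ### Estimates by region -/

/-- The product equals `e^w + e^{-w} - 2`. The cubic Taylor polynomials of the two exponentials add
up to `2 + w^2`, so only the two remainders of order four survive. -/
theorem norm_cexp_sub_one_mul_sub_sq_le {w : ℂ} (hw : ‖w‖ ≤ 1) :
    ‖(1 - exp (-w)) * (exp w - 1) - w ^ 2‖ ≤ ‖w‖ ^ 4 := by
  have h1 := Complex.exp_bound hw (n := 4) (by norm_num)
  have h2 := Complex.exp_bound (x := -w) (by simpa using hw) (n := 4) (by norm_num)
  have h3 : (1 - exp (-w)) * (exp w - 1) - w ^ 2 =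
      (exp w - ∑ m ∈ Finset.range 4, w ^ m / (m.factorial : ℂ)) +
        (exp (-w) - ∑ m ∈ Finset.range 4, (-w) ^ m / (m.factorial : ℂ)) := by
    have h4 : exp (-w) * exp w = 1 := by rw [← Complex.exp_add]; simp
    simp only [Finset.sum_range_succ, Finset.sum_range_zero, Nat.factorial]
    push_cast
    linear_combination -h4
  rw [h3]
  refine (norm_add_le _ _).trans ?_
  rw [norm_neg] at h2
  norm_num [Nat.factorial] at h1 h2
  have : 0 ≤ ‖w‖ ^ 4 := by positivity
  linarith

theorem exists_norm_psi_sub_le_of_norm_le_one {α : ℝ} (hα0 : 0 ≤ α) (hα : α < 1) :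
    ∃ c : ℝ, ∀ w ∈ slitPlane, ‖w‖ ≤ 1 →
      ‖(1 - exp (-w)) * psi α w - w ^ (α : ℂ)‖ ≤ c * ‖w‖ ^ 2 := by
  -- The `1` pays for the Taylor error times `w^{α-2}`; the `2` comes from `|(1 - e^{-w})(e^w - 1)|
  -- ≤ 2|w|^2`, multiplying the sum over `k ≠ 0`.
  refine ⟨1 + 2 * ∑' k : ℤ, |(k : ℝ)| ^ (-(2 - α)), fun w hw hw1 => ?_⟩
  have hs : 1 < 2 - α := by linarith
  have hπ : ‖w‖ < Real.pi := by linarith [Real.pi_gt_three]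
  have hw0 : w ≠ 0 := slitPlane_ne_zero hw
  have hn : 0 < ‖w‖ := norm_pos_iff.2 hw0
  have hS := norm_tsum_ite_add_two_pi_mul_I_cpow_le hs hπ
  have hL := polylog_cexp_neg_eq hs hw hπ
  have hE := norm_cexp_sub_one_mul_sub_sq_le hw1
  set S := ∑' k : ℤ, if k = 0 then 0 else (w + 2 * Real.pi * I * k) ^ (-(2 - α : ℝ) : ℂ)
  set M := ∑' k : ℤ, |(k : ℝ)| ^ (-(2 - α))
  have hG : ((Real.Gamma (2 - α) : ℝ) : ℂ) ≠ 0 := by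
    exact_mod_cast (Real.Gamma_pos_of_pos (by linarith)).ne'
  have hpow : w ^ (α : ℂ) = w ^ 2 * w ^ (-(2 - α : ℝ) : ℂ) := by
    rw [← Complex.cpow_ofNat w 2, ← Complex.cpow_add _ _ hw0]
    congr 1
    push_cast
    ring
  have hpsi : (1 - exp (-w)) * psi α w =
      (1 - exp (-w)) * (exp w - 1) * (w ^ (-(2 - α : ℝ) : ℂ) + S) := by
    rw [psi, show ((α : ℂ) - 1) = 1 - ((2 - α : ℝ) : ℂ) by push_cast; ring, hL,
      Complex.Gamma_ofReal]
    field_simp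
  rw [hpsi, hpow]
  have hE2 : ‖(1 - exp (-w)) * (exp w - 1)‖ ≤ 2 * ‖w‖ ^ 2 := by
    have := norm_add_le ((1 - exp (-w)) * (exp w - 1) - w ^ 2) (w ^ 2)
    rw [sub_add_cancel, norm_pow] at this
    linarith [pow_le_pow_of_le_one hn.le hw1 (show 2 ≤ 4 by norm_num)]
  set E := (1 - exp (-w)) * (exp w - 1)
  have hpn : ‖w‖ ^ 4 * ‖w ^ (-(2 - α : ℝ) : ℂ)‖ ≤ ‖w‖ ^ 2 := by
    have h1 : ‖w ^ (α : ℂ)‖ ≤ 1 := by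
      rw [Complex.norm_cpow_real]
      exact Real.rpow_le_one hn.le hw1 hα0
    calc ‖w‖ ^ 4 * ‖w ^ (-(2 - α : ℝ) : ℂ)‖ = ‖w‖ ^ 2 * ‖w ^ (α : ℂ)‖ := by
          rw [hpow, norm_mul, norm_pow]
          ring
      _ ≤ ‖w‖ ^ 2 := mul_le_of_le_one_right (by positivity) h1
  calc ‖E * (w ^ (-(2 - α : ℝ) : ℂ) + S) - w ^ 2 * w ^ (-(2 - α : ℝ) : ℂ)‖
      = ‖(E - w ^ 2) * w ^ (-(2 - α : ℝ) : ℂ) + E * S‖ := by ring_nf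
    _ ≤ ‖E - w ^ 2‖ * ‖w ^ (-(2 - α : ℝ) : ℂ)‖ + ‖E‖ * ‖S‖ := by
        refine (norm_add_le _ _).trans ?_
        rw [norm_mul, norm_mul]
    _ ≤ ‖w‖ ^ 4 * ‖w ^ (-(2 - α : ℝ) : ℂ)‖ + 2 * ‖w‖ ^ 2 * M := by gcongr
    _ ≤ (1 + 2 * M) * ‖w‖ ^ 2 := by linarith

theorem exists_norm_psi_le_of_one_le_re (α : ℝ) :
    ∃ c : ℝ, ∀ w : ℂ, 1 ≤ w.re → ‖(1 - exp (-w)) * psi α w‖ ≤ c := by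
  have hL := isPolylog_polylog ((α : ℂ) - 1)
  have hr : ‖((Real.exp (-1) : ℝ) : ℂ)‖ = Real.exp (-1) := by
    rw [Complex.norm_real, Real.norm_of_nonneg (Real.exp_pos _).le]
  have hsum := (hL.hasSum (Real.exp (-1) : ℝ) (by rw [hr]; simp)).summable.norm
  refine ⟨4 * (Real.exp 1 * ∑' j : ℕ,
    ‖((Real.exp (-1) : ℝ) : ℂ) ^ (j + 1) / ((j : ℂ) + 1) ^ ((α : ℂ) - 1)‖) /
      ‖((Real.Gamma (2 - α) : ℝ) : ℂ)‖, fun w hw => ?_⟩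
  have hq : ‖exp (-w)‖ ≤ Real.exp (-1) := by
    rw [Complex.norm_exp]
    exact Real.exp_le_exp.2 (by simpa using hw)
  have hq1 : ‖exp (-w)‖ < 1 := hq.trans_lt (by simp)
  have hee : Real.exp 1 * Real.exp (-1) = 1 := by rw [← Real.exp_add]; simp
  -- With `q = e^{-w}`, `|q|^{j+1} ≤ |q| e^{-j} = |q| · e · e^{-(j+1)}`: one factor `|q|` is kept to
  -- absorb `e^w - 1`.
  have hLi : ‖polylog ((α : ℂ) - 1) (exp (-w))‖ ≤ ‖exp (-w)‖ * (Real.exp 1 * ∑' j : ℕ,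
      ‖((Real.exp (-1) : ℝ) : ℂ) ^ (j + 1) / ((j : ℂ) + 1) ^ ((α : ℂ) - 1)‖) := by
    rw [← (hL.hasSum _ hq1).tsum_eq, ← mul_assoc]
    refine tsum_of_norm_bounded (hsum.hasSum.mul_left _) fun j => ?_
    rw [norm_div, norm_div, norm_pow, norm_pow, hr, pow_succ', pow_succ', mul_div_assoc,
      mul_assoc, mul_div_assoc, ← mul_assoc (Real.exp 1), hee, one_mul]
    gcongr
  have hfac : (1 - exp (-w)) * psi α w =
      (1 - exp (-w)) * (exp w - 1) * polylog ((α : ℂ) - 1) (exp (-w)) /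
        ((Real.Gamma (2 - α) : ℝ) : ℂ) := by
    rw [psi]
    ring
  have h1 : ‖1 - exp (-w)‖ ≤ 2 := by
    refine (norm_sub_le _ _).trans ?_
    rw [norm_one]
    linarith
  have h2 : ‖exp w - 1‖ * ‖exp (-w)‖ ≤ 2 := by
    rw [← norm_mul, sub_mul, ← Complex.exp_add, add_neg_cancel, Complex.exp_zero, one_mul]
    exact h1
  rw [hfac, norm_div, norm_mul, norm_mul]
  refine div_le_div_of_nonneg_right ?_ (norm_nonneg _)
  set B := Real.exp 1 * ∑' j : ℕ,
      ‖((Real.exp (-1) : ℝ) : ℂ) ^ (j + 1) / ((j : ℂ) + 1) ^ ((α : ℂ) - 1)‖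
  have hB : 0 ≤ B := by positivity
  calc ‖1 - exp (-w)‖ * ‖exp w - 1‖ * ‖polylog ((α : ℂ) - 1) (exp (-w))‖
      ≤ ‖1 - exp (-w)‖ * ‖exp w - 1‖ * (‖exp (-w)‖ * B) := by gcongr
    _ = ‖1 - exp (-w)‖ * (‖exp w - 1‖ * ‖exp (-w)‖) * B := by ring
    _ ≤ 2 * 2 * B := by gcongr
    _ = 4 * B := by ring

theorem mem_slitPlane_of_mul_norm_le_re {κ : ℝ} (hκ : -1 < κ) {w : ℂ} (hw : w ≠ 0)
    (h : κ * ‖w‖ ≤ w.re) : w ∈ slitPlane := by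
  by_contra hns
  rw [mem_slitPlane_iff, not_or, not_lt, not_not] at hns
  have h1 : ‖w‖ ≤ -w.re := by
    have := Complex.norm_le_abs_re_add_abs_im w
    rwa [hns.2, abs_zero, add_zero, abs_of_nonpos hns.1] at this
  nlinarith [norm_pos_iff.2 hw]

/-- Compactness: the region is closed and lies where the function is continuous. It is bounded
because, when `Re w ≤ 0`, `‖w‖ ≤ -Re w + |Im w| ≤ -κ‖w‖ + π`, so `‖w‖ ≤ π / (1 + κ)`. -/
theorem exists_norm_psi_sub_le_of_re_le_one (α : ℝ) {κ : ℝ} (hκ : -1 < κ) :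
    ∃ c : ℝ, ∀ w : ℂ, 1 ≤ ‖w‖ → w.re ≤ 1 → κ * ‖w‖ ≤ w.re → |w.im| ≤ Real.pi →
      ‖(1 - exp (-w)) * psi α w - w ^ (α : ℂ)‖ ≤ c := by
  obtain ⟨K, hK⟩ : ∃ K : Set ℂ, K =
      {w | 1 ≤ ‖w‖} ∩ {w | w.re ≤ 1} ∩ {w | κ * ‖w‖ ≤ w.re} ∩ {w | |w.im| ≤ Real.pi} := ⟨_, rfl⟩
  have hmem : ∀ w ∈ K, 1 ≤ ‖w‖ ∧ w.re ≤ 1 ∧ κ * ‖w‖ ≤ w.re ∧ |w.im| ≤ Real.pi := by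
    intro w hw
    rw [hK] at hw
    exact ⟨hw.1.1.1, hw.1.1.2, hw.1.2, hw.2⟩
  have hclosed : IsClosed K := by
    rw [hK]
    exact (((isClosed_le (by fun_prop) (by fun_prop)).inter
      (isClosed_le (by fun_prop) (by fun_prop))).inter
      (isClosed_le (by fun_prop) (by fun_prop))).inter (isClosed_le (by fun_prop) (by fun_prop))
  have hbdd : K ⊆ Metric.closedBall 0 (Real.pi / (1 + κ) + (1 + Real.pi)) := by
    intro w hw
    obtain ⟨-, h2, h3, h4⟩ := hmem w hw
    have hpos : 0 ≤ Real.pi / (1 + κ) := div_nonneg Real.pi_pos.le (by linarith)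
    have h5 := Complex.norm_le_abs_re_add_abs_im w
    rw [mem_closedBall_zero_iff]
    rcases le_total 0 w.re with h | h
    · rw [abs_of_nonneg h] at h5
      linarith
    · rw [abs_of_nonpos h] at h5
      have : ‖w‖ ≤ Real.pi / (1 + κ) := by
        rw [le_div_iff₀ (by linarith)]
        linarith
      linarith [Real.pi_pos]
  have hslit : ∀ w ∈ K, w ∈ slitPlane := fun w hw =>
    mem_slitPlane_of_mul_norm_le_re hκ
      (norm_pos_iff.1 (zero_lt_one.trans_le (hmem w hw).1)) (hmem w hw).2.2.1
  have hcont : ContinuousOn (fun w => (1 - exp (-w)) * psi α w - w ^ (α : ℂ)) K := by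
    have hLi : ContinuousOn (fun w => polylog ((α : ℂ) - 1) (exp (-w))) K :=
      (isPolylog_polylog _).differentiableOn.continuousOn.comp (by fun_prop) fun w hw =>
        cexp_neg_mem_polylogDomain (hslit w hw) (hmem w hw).2.2.2
    have hpsi : ContinuousOn (psi α) K :=
      ContinuousOn.mul (f := fun w => (exp w - 1) / ((Real.Gamma (2 - α) : ℝ) : ℂ))
        (by fun_prop) hLi
    have hpow : ContinuousOn (fun w : ℂ => w ^ (α : ℂ)) K := fun w hw =>
      (continuousAt_id.cpow continuousAt_const (hslit w hw)).continuousWithinAt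
    exact (ContinuousOn.mul (by fun_prop) hpsi).sub hpow
  obtain ⟨c, hc⟩ :=
    ((isCompact_closedBall _ _).of_isClosed_subset hclosed hbdd).exists_bound_of_continuousOn hcont
  refine ⟨c, fun w h1 h2 h3 h4 => hc w ?_⟩
  rw [hK]
  exact ⟨⟨⟨h1, h2⟩, h3⟩, h4⟩

theorem exists_norm_psi_sub_le {α κ : ℝ} (hα : α ∈ Ioo (0 : ℝ) 1) (hκ : -1 < κ) :
    ∃ c : ℝ, 0 < c ∧ ∀ w : ℂ, w ≠ 0 → κ * ‖w‖ ≤ w.re → |w.im| ≤ Real.pi →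
      ‖(1 - exp (-w)) * psi α w - w ^ (α : ℂ)‖ ≤ c * ‖w‖ ^ 2 := by
  obtain ⟨c₁, h₁⟩ := exists_norm_psi_sub_le_of_norm_le_one hα.1.le hα.2
  obtain ⟨c₂, h₂⟩ := exists_norm_psi_le_of_one_le_re α
  obtain ⟨c₃, h₃⟩ := exists_norm_psi_sub_le_of_re_le_one α hκ
  refine ⟨|c₁| + |c₂| + |c₃| + 1, by positivity, fun w hw hre him => ?_⟩
  have a₁ := abs_nonneg c₁
  have a₂ := abs_nonneg c₂
  have a₃ := abs_nonneg c₃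
  rcases le_total ‖w‖ 1 with hn | hn
  · refine (h₁ w (mem_slitPlane_of_mul_norm_le_re hκ hw hre) hn).trans ?_
    gcongr
    linarith [le_abs_self c₁]
  have hn2 : 1 ≤ ‖w‖ ^ 2 := one_le_pow₀ hn
  rcases le_total w.re 1 with h | h
  · refine (h₃ w hn h hre him).trans ?_
    nlinarith [le_abs_self c₃]
  · have hpow : ‖w ^ (α : ℂ)‖ ≤ ‖w‖ ^ 2 := by
      rw [Complex.norm_cpow_real, ← Real.rpow_natCast]
      exact Real.rpow_le_rpow_of_exponent_le hn (by push_cast; linarith [hα.2])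
    have := (norm_sub_le _ _).trans (add_le_add (h₂ w h) hpow)
    nlinarith [le_abs_self c₂]

/-! ### Scaling back to the contour -/

theorem mainTheorem6 (α θ : ℝ) (hα : α ∈ Set.Ioo (0 : ℝ) 1)
    (hθ : θ ∈ Set.Ioo (Real.pi / 2) (5 * Real.pi / 6)) :
    ∃ c : ℝ, 0 < c ∧ ∀ δ : ℝ, 0 < δ → ∀ τ : ℝ, 0 < τ → ∀ z ∈ truncatedContour θ δ τ,
      ‖(1 - Complex.exp (-(z * (τ : ℂ)))) / ((τ ^ α : ℝ) : ℂ) * psi α (z * (τ : ℂ))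
          - z ^ (α : ℂ)‖ ≤ c * ‖z‖ ^ 2 * τ ^ (2 - α) := by
  have hπ := Real.pi_pos
  obtain ⟨h1, h2⟩ := hθ
  have hcos : -1 < Real.cos θ := by
    rw [← Real.cos_pi]
    exact Real.cos_lt_cos_of_nonneg_of_le_pi (by linarith) le_rfl (by linarith)
  obtain ⟨c, hc, hcw⟩ := exists_norm_psi_sub_le hα hcos
  refine ⟨c, hc, fun δ hδ τ hτ z hz => ?_⟩
  obtain ⟨hz1, hz2⟩ := hz
  -- On the arc `|arg z| ≤ θ` gives `cos (arg z) ≥ cos θ`; on both rays equality holds.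
  have hz' : z ≠ 0 ∧ Real.cos θ * ‖z‖ ≤ z.re := by
    rcases hz1 with ⟨hn, ha⟩ | ⟨ρ, hρ, hz⟩
    · have h0 : z ≠ 0 := norm_pos_iff.1 (hn ▸ hδ)
      refine ⟨h0, ?_⟩
      have := Real.cos_le_cos_of_nonneg_of_le_pi (abs_nonneg _) (by linarith) ha
      rw [Real.cos_abs, Complex.cos_arg h0, le_div_iff₀ (norm_pos_iff.2 h0)] at this
      exact this
    · have hρ0 : 0 < ρ := by linarith
      rcases hz with rfl | rfl
      · refine ⟨by simp [hρ0.ne'], ?_⟩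
        simp [Complex.norm_exp, Complex.exp_re, abs_of_pos hρ0, mul_comm]
      · refine ⟨by simp [hρ0.ne'], ?_⟩
        simp [Complex.norm_exp, Complex.exp_re, abs_of_pos hρ0, mul_comm]
  have hτn : ‖(τ : ℂ)‖ = τ := by rw [Complex.norm_real, Real.norm_of_nonneg hτ.le]
  have key := hcw (z * τ) (mul_ne_zero hz'.1 (by exact_mod_cast hτ.ne'))
    (by rw [norm_mul, hτn, re_mul_ofReal, ← mul_assoc]; gcongr; exact hz'.2)
    (by
      rw [im_mul_ofReal, abs_mul, abs_of_pos hτ]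
      exact (le_div_iff₀ hτ).1 hz2)
  have hτα : (0 : ℝ) < τ ^ α := by positivity
  have hτα' : ((τ ^ α : ℝ) : ℂ) ≠ 0 := by exact_mod_cast hτα.ne'
  have hpow : (z * τ) ^ (α : ℂ) = ((τ ^ α : ℝ) : ℂ) * z ^ (α : ℂ) := by
    have hτ0 : (τ : ℂ) ≠ 0 := by exact_mod_cast hτ.ne'
    rw [mul_comm z, Complex.ofReal_cpow hτ.le, Complex.cpow_def_of_ne_zero (mul_ne_zero hτ0 hz'.1),
      Complex.cpow_def_of_ne_zero hτ0, Complex.cpow_def_of_ne_zero hz'.1,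
      Complex.log_ofReal_mul hτ hz'.1, ← Complex.exp_add, Complex.ofReal_log hτ.le, add_mul]
  have heq : (1 - Complex.exp (-(z * (τ : ℂ)))) / ((τ ^ α : ℝ) : ℂ) * psi α (z * (τ : ℂ))
      - z ^ (α : ℂ) = ((1 - Complex.exp (-(z * (τ : ℂ)))) * psi α (z * (τ : ℂ))
        - (z * τ) ^ (α : ℂ)) / ((τ ^ α : ℝ) : ℂ) := by
    rw [hpow]
    field_simp
  rw [heq, norm_div, Complex.norm_real, Real.norm_of_nonneg hτα.le, div_le_iff₀ hτα]
  refine key.trans_eq ?_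
  rw [norm_mul, hτn, mul_assoc _ (τ ^ (2 - α)), ← Real.rpow_add hτ, sub_add_cancel]
  norm_num
  ring
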